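/- Throughout, a compact quantum group $G=(A,\Delta)$ in the sense of Woronowicz consists of a unital $C^*$-algebra $A$ and a unital $*$-homomorphism $\Delta:A\to A\otimes A$ into the minimal $C^*$-tensor product such that $(\Delta\otimes\mathrm{id})\Delta=(\mathrm{id}\otimes\Delta)\Delta$ and such that the linear spans of $\Delta(A)(1\otimes A)$ and of $\Delta(A)(A\otimes 1)$ are dense in $A\otimes A$. An $n$-dimensional unitary representation of $G$ is a unitary matrix $u=(u_{ij})\in M_n(A)$ with $\Delta(u_{ij})=\sum_{k=1}^n u_{ik}\otimes u_{kj}$ for all $i,j$; it is trivial if $u$ is the identity matrix $1\in M_n(A)$. The linear span of the matrix coefficients of all finite-dimensional unitary representations is the dense Hopf $*$-algebra of $G$. The quantum group $G$ is connected if this Hopf $*$-algebra contains no finite-dimensional Hopf $*$-subalgebra other than $\mathbb{C}1$, and cocommutative if $\Delta=\tau\circ\Delta$, where $\tau$ is the flip $a\otimes b\mapsto b\otimes a$ of $A\otimes A$. **Corollary.** Let $G=(A,\Delta)$ be a connected cocommutative compact quantum group and let $u\in M_n(A)$ be a non-trivial finite-dimensional unitary representation of $G$. Then the spectrum of $u$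 in the $C^*$-algebra $M_n(A)$ is the whole unit circle: $\sigma(u)=\mathbb{T}=\{z\in\mathbb{C}:|z|=1\}$. -/

import Mathlib

open scoped TensorProduct ENNReal InnerProductSpace

universe u

noncomputable section

/-! ## Hilbert space tensor products -/

/-- The Hilbert space tensor product: the completion of the algebraic tensor product for the inner
product `⟪x ⊗ y, x' ⊗ y'⟫ = ⟪x, x'⟫ ⟪y, y'⟫`. -/
def HTensor (H K : Type u) [NormedAddCommGroup H] [InnerProductSpace ℂ H]
    [NormedAddCommGroup K] [InnerProductSpace ℂ K] : Type u :=
  UniformSpace.Completion (H ⊗[ℂ] K)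

namespace HTensor

variable {H K L : Type u}
  [NormedAddCommGroup H] [InnerProductSpace ℂ H]
  [NormedAddCommGroup K] [InnerProductSpace ℂ K]
  [NormedAddCommGroup L] [InnerProductSpace ℂ L]

instance : NormedAddCommGroup (HTensor H K) :=
  inferInstanceAs (NormedAddCommGroup (UniformSpace.Completion (H ⊗[ℂ] K)))

instance : InnerProductSpace ℂ (HTensor H K) :=
  inferInstanceAs (InnerProductSpace ℂ (UniformSpace.Completion (H ⊗[ℂ] K)))

instance : CompleteSpace (HTensor H K) :=
  inferInstanceAs (CompleteSpace (UniformSpace.Completion (H ⊗[ℂ] K)))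

variable (H K) in
/-- The isometric inclusion of the algebraic tensor product. -/
def incl : H ⊗[ℂ] K →ₗᵢ[ℂ] HTensor H K :=
  UniformSpace.Completion.toComplₗᵢ (𝕜 := ℂ) (E := H ⊗[ℂ] K)

variable (H K) in
theorem denseRange_incl : DenseRange (incl H K) :=
  UniformSpace.Completion.denseRange_coe (α := H ⊗[ℂ] K)

/-- The elementary tensor `x ⊗ y`. -/
def tmul (x : H) (y : K) : HTensor H K := incl H K (x ⊗ₜ[ℂ] y)

theorem norm_tmul (x : H) (y : K) : ‖tmul x y‖ = ‖x‖ * ‖y‖ := by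
  rw [tmul, LinearIsometry.norm_map, TensorProduct.norm_tmul]

instance [Nontrivial H] [Nontrivial K] : Nontrivial (HTensor H K) := by
  obtain ⟨x, hx⟩ := exists_ne (0 : H)
  obtain ⟨y, hy⟩ := exists_ne (0 : K)
  refine ⟨⟨tmul x y, 0, ?_⟩⟩
  rw [← norm_ne_zero_iff, norm_tmul]
  exact mul_ne_zero (norm_ne_zero_iff.2 hx) (norm_ne_zero_iff.2 hy)

@[elab_as_elim]
theorem induction {P : HTensor H K → Prop} (z : HTensor H K) (hP : IsClosed {z | P z})
    (h0 : P 0) (ht : ∀ x y, P (tmul x y)) (ha : ∀ a b, P a → P b → P (a + b)) : P z := by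
  refine (denseRange_incl H K).induction_on z hP fun t => ?_
  induction t using TensorProduct.induction_on with
  | zero => rwa [map_zero]
  | tmul x y => exact ht x y
  | add a b hx hy => rw [map_add]; exact ha _ _ hx hy

/-- Continuous linear maps out of `H ⊗ K` that agree on elementary tensors are equal. -/
theorem ext_tmul {E : Type*} [NormedAddCommGroup E] [NormedSpace ℂ E]
    {S T : HTensor H K →L[ℂ] E} (h : ∀ x y, S (tmul x y) = T (tmul x y)) : S = T := by
  ext z
  induction z using HTensor.induction with
  | hP => exact isClosed_eq S.continuous T.continuous
  | h0 => rw [map_zero, map_zero]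
  | ht x y => exact h x y
  | ha a b ha hb => rw [map_add, map_add, ha, hb]

/-- The operator `S ⊗ T` on `H ⊗ K`. -/
def map (S : H →L[ℂ] H) (T : K →L[ℂ] K) : HTensor H K →L[ℂ] HTensor H K :=
  ContinuousLinearMap.completion (TensorProduct.mapL S T)

theorem map_incl (S : H →L[ℂ] H) (T : K →L[ℂ] K) (t : H ⊗[ℂ] K) :
    map S T (incl H K t) = incl H K (TensorProduct.mapL S T t) :=
  ContinuousLinearMap.completion_apply_coe (TensorProduct.mapL S T) t

@[simp] theorem map_tmul (S : H →L[ℂ] H) (T : K →L[ℂ] K) (x : H) (y : K) :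
    map S T (tmul x y) = tmul (S x) (T y) :=
  map_incl S T _

theorem tmul_add_left (x x' : H) (y : K) : tmul (x + x') y = tmul x y + tmul x' y := by
  rw [tmul, TensorProduct.add_tmul, map_add]; rfl

theorem tmul_add_right (x : H) (y y' : K) : tmul x (y + y') = tmul x y + tmul x y' := by
  rw [tmul, TensorProduct.tmul_add, map_add]; rfl

theorem tmul_smul_left (c : ℂ) (x : H) (y : K) : tmul (c • x) y = c • tmul x y := by
  rw [tmul, ← TensorProduct.smul_tmul', map_smul, tmul]

theorem tmul_smul_right (c : ℂ) (x : H) (y : K) : tmul x (c • y) = c • tmul x y := by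
  rw [tmul, TensorProduct.tmul_smul, map_smul, tmul]

@[simp] theorem zero_tmul (y : K) : tmul (0 : H) y = 0 := by
  rw [tmul, TensorProduct.zero_tmul, map_zero]

@[simp] theorem tmul_zero (x : H) : tmul x (0 : K) = 0 := by
  rw [tmul, TensorProduct.tmul_zero, map_zero]

theorem inner_tmul (x x' : H) (y y' : K) :
    ⟪tmul x y, tmul x' y'⟫_ℂ = ⟪x, x'⟫_ℂ * ⟪y, y'⟫_ℂ := by
  rw [tmul, tmul, LinearIsometry.inner_map_map, TensorProduct.inner_tmul]

theorem map_mul_map (S S' : H →L[ℂ] H) (T T' : K →L[ℂ] K) :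
    map S T * map S' T' = map (S * S') (T * T') :=
  ext_tmul fun x y => by simp

theorem map_one_one : map (1 : H →L[ℂ] H) (1 : K →L[ℂ] K) = 1 :=
  ext_tmul fun x y => by simp

theorem star_map [CompleteSpace H] [CompleteSpace K] (S : H →L[ℂ] H) (T : K →L[ℂ] K) :
    star (map S T) = map (star S) (star T) := by
  refine ext_tmul fun x y => ?_
  refine ext_inner_left ℂ fun z => ?_
  induction z using HTensor.induction with
  | hP => exact isClosed_eq (by fun_prop) (by fun_prop)
  | h0 => rw [inner_zero_left, inner_zero_left]
  | ht a b =>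
    rw [ContinuousLinearMap.star_eq_adjoint, ContinuousLinearMap.adjoint_inner_right,
      map_tmul, map_tmul, inner_tmul, inner_tmul, ContinuousLinearMap.star_eq_adjoint,
      ContinuousLinearMap.star_eq_adjoint, ContinuousLinearMap.adjoint_inner_right,
      ContinuousLinearMap.adjoint_inner_right]
  | ha a b ha hb => rw [inner_add_left, inner_add_left, ha, hb]

variable (H K) in
/-- The amplification `S ↦ S ⊗ 1`. -/
def leftHom [CompleteSpace H] [CompleteSpace K] :
    (H →L[ℂ] H) →⋆ₐ[ℂ] (HTensor H K →L[ℂ] HTensor H K) where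
  toFun S := map S 1
  map_one' := map_one_one
  map_mul' S T := by rw [map_mul_map, one_mul]
  map_zero' := ext_tmul fun x y => by simp
  map_add' S T := ext_tmul fun x y => by simp [tmul_add_left]
  commutes' c := ext_tmul fun x y => by
    simp [Algebra.algebraMap_eq_smul_one, tmul_smul_left]
  map_star' S := by rw [star_map, star_one]

variable (H K) in
/-- The amplification `T ↦ 1 ⊗ T`. -/
def rightHom [CompleteSpace H] [CompleteSpace K] :
    (K →L[ℂ] K) →⋆ₐ[ℂ] (HTensor H K →L[ℂ] HTensor H K) where
  toFun T := map 1 T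
  map_one' := map_one_one
  map_mul' S T := by rw [map_mul_map, one_mul]
  map_zero' := ext_tmul fun x y => by simp
  map_add' S T := ext_tmul fun x y => by simp [tmul_add_right]
  commutes' c := ext_tmul fun x y => by
    simp [Algebra.algebraMap_eq_smul_one, tmul_smul_right]
  map_star' S := by rw [star_map, star_one]

/-- A linear map into `H ⊗ K` whose range meets, for `x`, `y` in dense sets, every `x ⊗ y` has dense
range. -/
theorem denseRange_of_tmul {E : Type*} [AddCommGroup E] [Module ℂ E] (f : E →ₗ[ℂ] HTensor H K)
    {X Y : Type*} {i : X → H} {j : Y → K} (hi : DenseRange i) (hj : DenseRange j)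
    (h : ∀ x y, ∃ e, f e = tmul (i x) (j y)) : DenseRange f := by
  have hc : Continuous fun p : H × K => tmul p.1 p.2 :=
    (incl H K).continuous.comp TensorProduct.continuous_tmul
  have h1 : ∀ x y, tmul x y ∈ (LinearMap.range f).topologicalClosure := by
    intro x y
    have : ∀ p : H × K, tmul p.1 p.2 ∈ closure (LinearMap.range f : Set (HTensor H K)) := by
      intro p
      refine (hi.prodMap hj).induction_on p (isClosed_closure.preimage hc) ?_
      rintro ⟨a, b⟩
      obtain ⟨e, he⟩ := h a b
      exact subset_closure ⟨e, he⟩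
    exact this (x, y)
  have h2 : ∀ z : HTensor H K, z ∈ (LinearMap.range f).topologicalClosure := by
    intro z
    induction z using HTensor.induction with
    | hP => exact (LinearMap.range f).isClosed_topologicalClosure
    | h0 => exact Submodule.zero_mem _
    | ht x y => exact h1 x y
    | ha a b ha hb => exact Submodule.add_mem _ ha hb
  intro z
  exact h2 z

variable (H K) in
/-- The flip `x ⊗ y ↦ y ⊗ x`. -/
def comm : HTensor H K ≃ₗᵢ[ℂ] HTensor K H :=
  (TensorProduct.comm ℂ H K).extendOfIsometry
    (incl H K).toLinearMap (incl K H).toLinearMap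
    (denseRange_incl H K) (denseRange_incl K H) (fun x => by simp)

@[simp] theorem comm_tmul (x : H) (y : K) : comm H K (tmul x y) = tmul y x :=
  LinearEquiv.extendOfIsometry_eq _ _ _ (denseRange_incl H K) (denseRange_incl K H)
    (fun x => by simp) (x ⊗ₜ[ℂ] y)

variable (H K L) in
/-- `(x ⊗ y) ⊗ z ↦ (x ⊗ y) ⊗ z` from the algebraic to the Hilbert space tensor product. -/
def incl₁ : (H ⊗[ℂ] K) ⊗[ℂ] L →ₗᵢ[ℂ] HTensor (HTensor H K) L :=
  (incl _ _).comp (TensorProduct.mapIsometry (incl H K) LinearIsometry.id)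

variable (H K L) in
/-- `x ⊗ (y ⊗ z) ↦ x ⊗ (y ⊗ z)` from the algebraic to the Hilbert space tensor product. -/
def incl₂ : H ⊗[ℂ] (K ⊗[ℂ] L) →ₗᵢ[ℂ] HTensor H (HTensor K L) :=
  (incl _ _).comp (TensorProduct.mapIsometry LinearIsometry.id (incl K L))

theorem denseRange_incl₁ : DenseRange (incl₁ H K L).toLinearMap :=
  denseRange_of_tmul _ (denseRange_incl H K) denseRange_id
    fun x y => ⟨x ⊗ₜ y, rfl⟩

theorem denseRange_incl₂ : DenseRange (incl₂ H K L).toLinearMap :=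
  denseRange_of_tmul _ denseRange_id (denseRange_incl K L)
    fun x y => ⟨x ⊗ₜ y, rfl⟩

theorem norm_incl_assoc (x : (H ⊗[ℂ] K) ⊗[ℂ] L) :
    ‖(incl₂ H K L).toLinearMap (TensorProduct.assoc ℂ H K L x)‖ =
      ‖(incl₁ H K L).toLinearMap x‖ :=
  ((incl₂ H K L).norm_map _).trans
    ((TensorProduct.norm_assoc x).trans ((incl₁ H K L).norm_map x).symm)

variable (H K L) in
/-- The associator `(x ⊗ y) ⊗ z ↦ x ⊗ (y ⊗ z)`. -/
def assoc : HTensor (HTensor H K) L ≃ₗᵢ[ℂ] HTensor H (HTensor K L) :=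
  (TensorProduct.assoc ℂ H K L).extendOfIsometry (incl₁ H K L).toLinearMap
    (incl₂ H K L).toLinearMap denseRange_incl₁ denseRange_incl₂ norm_incl_assoc

@[simp] theorem assoc_tmul (x : H) (y : K) (z : L) :
    assoc H K L (tmul (tmul x y) z) = tmul x (tmul y z) :=
  LinearEquiv.extendOfIsometry_eq _ _ _ denseRange_incl₁ denseRange_incl₂ norm_incl_assoc
    ((x ⊗ₜ[ℂ] y) ⊗ₜ[ℂ] z)

end HTensor

/-! ## The minimal (spatial) tensor product of C⋆-algebras -/

/-- A unital ⋆-representation of a C⋆-algebra on a nonzero Hilbert space. -/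
structure CStarRep (A : Type u) [CStarAlgebra A] : Type (u + 1) where
  H : Type u
  [normedAddCommGroup : NormedAddCommGroup H]
  [innerProductSpace : InnerProductSpace ℂ H]
  [completeSpace : CompleteSpace H]
  [nontrivial : Nontrivial H]
  π : A →⋆ₐ[ℂ] (H →L[ℂ] H)

attribute [instance] CStarRep.normedAddCommGroup CStarRep.innerProductSpace
  CStarRep.completeSpace CStarRep.nontrivial

/-- The C⋆-algebraic product (`ℓ^∞`-direct sum) of a family of unital C⋆-algebras: the bounded
families, with pointwise operations and the supremum norm. -/
def CStarProd {I : Type*} (E : I → Type*) [∀ i, CStarAlgebra (E i)] [∀ i, Nontrivial (E i)] :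
    Type _ :=
  lp E ∞

namespace CStarProd

variable {I : Type*} {E : I → Type*} [∀ i, CStarAlgebra (E i)] [∀ i, Nontrivial (E i)]

instance : CStarAlgebra (CStarProd E) :=
  letI : CStarAlgebra (lp E ∞) := { }
  inferInstanceAs (CStarAlgebra (lp E ∞))

variable (E) in
/-- The coordinate maps. -/
def eval (i : I) : CStarProd E →⋆ₐ[ℂ] E i where
  toFun x := (show lp E ∞ from x) i
  map_one' := rfl
  map_mul' _ _ := rfl
  map_zero' := rfl
  map_add' _ _ := rfl
  commutes' _ := rfl
  map_star' _ := rfl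

theorem ext {x y : CStarProd E} (h : ∀ i, eval E i x = eval E i y) : x = y :=
  lp.ext (funext h)

/-- A ⋆-homomorphism into the product from its coordinates. -/
def lift {R : Type*} [Ring R] [Algebra ℂ R] [StarRing R]
    (f : ∀ i, R →⋆ₐ[ℂ] E i) (hf : ∀ x, ∃ C : ℝ, ∀ i, ‖f i x‖ ≤ C) : R →⋆ₐ[ℂ] CStarProd E where
  toFun x := show lp E ∞ from ⟨fun i => f i x, memℓp_infty (by
    obtain ⟨C, hC⟩ := hf x
    exact ⟨C, by rintro _ ⟨i, rfl⟩; exact hC i⟩)⟩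
  map_one' := ext fun i => map_one (f i)
  map_mul' x y := ext fun i => map_mul (f i) x y
  map_zero' := ext fun i => map_zero (f i)
  map_add' x y := ext fun i => map_add (f i) x y
  commutes' c := ext fun i => AlgHomClass.commutes (f i) c
  map_star' x := ext fun i => map_star (f i) x

@[simp] theorem eval_lift {R : Type*} [Ring R] [Algebra ℂ R] [StarRing R]
    (f : ∀ i, R →⋆ₐ[ℂ] E i) (hf : ∀ x, ∃ C : ℝ, ∀ i, ‖f i x‖ ≤ C) (i : I) (x : R) :
    eval E i (lift f hf x) = f i x :=
  rfl

end CStarProd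

/-- The C⋆-algebra `∏ B(H_π ⊗ H_ρ)` of bounded families, over all representations `π` of `A` and `ρ`
of `B`. -/
abbrev Spatial (A B : Type u) [CStarAlgebra A] [CStarAlgebra B] : Type (u + 1) :=
  CStarProd fun p : CStarRep A × CStarRep B =>
    HTensor p.1.H p.2.H →L[ℂ] HTensor p.1.H p.2.H

/-- The C⋆-algebra `∏ B(H_π ⊗ (H_ρ ⊗ H_σ))` of bounded families, over all representations `π` of
`A`, `ρ` of `B` and `σ` of `C`. It contains `A ⊗ B ⊗ C`. -/
abbrev Spatial₃ (A B C : Type u) [CStarAlgebra A] [CStarAlgebra B] [CStarAlgebra C] :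
    Type (u + 1) :=
  CStarProd fun p : CStarRep A × CStarRep B × CStarRep C =>
    HTensor p.1.H (HTensor p.2.1.H p.2.2.H) →L[ℂ] HTensor p.1.H (HTensor p.2.1.H p.2.2.H)

section MinTensor

variable {A B C : Type u} [CStarAlgebra A] [CStarAlgebra B] [CStarAlgebra C]

/-- The representation `π ⊗ ρ` of the algebraic tensor product on `H_π ⊗ H_ρ`. -/
def algRep (p : CStarRep A) (q : CStarRep B) :
    A ⊗[ℂ] B →⋆ₐ[ℂ] (HTensor p.H q.H →L[ℂ] HTensor p.H q.H) where
  toAlgHom := Algebra.TensorProduct.lift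
    ((HTensor.leftHom p.H q.H).comp p.π).toAlgHom ((HTensor.rightHom p.H q.H).comp q.π).toAlgHom
    (fun a b => by
      change HTensor.map (p.π a) 1 * HTensor.map 1 (q.π b) =
        HTensor.map 1 (q.π b) * HTensor.map (p.π a) 1
      simp [HTensor.map_mul_map])
  map_star' t := by
    induction t using TensorProduct.induction_on with
    | zero => simp
    | tmul a b =>
      change HTensor.map (p.π (star a)) 1 * HTensor.map 1 (q.π (star b)) =
        star (HTensor.map (p.π a) 1 * HTensor.map 1 (q.π b))
      simp [HTensor.map_mul_map, HTensor.star_map, map_star]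
    | add s t hs ht =>
      rw [star_add]
      exact (map_add _ _ _).trans ((congrArg₂ (· + ·) hs ht).trans
        ((star_add _ _).symm.trans (congrArg star (map_add _ _ _).symm)))

theorem algRep_tmul (p : CStarRep A) (q : CStarRep B) (a : A) (b : B) :
    algRep p q (a ⊗ₜ b) = HTensor.map (p.π a) (q.π b) := by
  change HTensor.map (p.π a) 1 * HTensor.map 1 (q.π b) = _
  simp [HTensor.map_mul_map]

theorem HTensor.norm_map_le {H K : Type u} [NormedAddCommGroup H] [InnerProductSpace ℂ H]
    [NormedAddCommGroup K] [InnerProductSpace ℂ K] (S : H →L[ℂ] H) (T : K →L[ℂ] K) :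
    ‖HTensor.map S T‖ ≤ ‖S‖ * ‖T‖ := by
  refine ContinuousLinearMap.opNorm_le_bound _ (by positivity) fun z => ?_
  refine (HTensor.denseRange_incl H K).induction_on z
    (isClosed_le (by fun_prop) (by fun_prop)) fun t => ?_
  rw [HTensor.map_incl, LinearIsometry.norm_map, LinearIsometry.norm_map]
  exact (ContinuousLinearMap.le_opNorm _ _).trans
    (mul_le_mul_of_nonneg_right (TensorProduct.norm_mapL_le S T) (norm_nonneg _))

theorem algRep_bounded (t : A ⊗[ℂ] B) :
    ∃ C : ℝ, ∀ p : CStarRep A × CStarRep B, ‖algRep p.1 p.2 t‖ ≤ C := by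
  induction t using TensorProduct.induction_on with
  | zero => exact ⟨0, fun p => by simp⟩
  | tmul a b =>
    refine ⟨‖a‖ * ‖b‖, fun p => ?_⟩
    rw [algRep_tmul]
    exact (HTensor.norm_map_le _ _).trans (mul_le_mul (NonUnitalStarAlgHom.norm_apply_le p.1.π a)
      (NonUnitalStarAlgHom.norm_apply_le p.2.π b) (norm_nonneg _) (norm_nonneg _))
  | add s t hs ht =>
    obtain ⟨C, hC⟩ := hs
    obtain ⟨D, hD⟩ := ht
    refine ⟨C + D, fun p => ?_⟩
    rw [map_add]
    exact (norm_add_le _ _).trans (add_le_add (hC p) (hD p))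

variable (A B) in
/-- The canonical map of the algebraic tensor product `A ⊗ B` into `∏ B(H_π ⊗ H_ρ)`. The norm that
it induces is the minimal C⋆-norm `‖t‖ = sup_{π, ρ} ‖(π ⊗ ρ)(t)‖`. -/
def algToSpatial : A ⊗[ℂ] B →⋆ₐ[ℂ] Spatial A B :=
  CStarProd.lift (fun p => algRep p.1 p.2) algRep_bounded

variable (A B) in
/-- The minimal (spatial) tensor product of two unital C⋆-algebras: the closure of the algebraic
tensor product for the norm `‖t‖ = sup_{π, ρ} ‖(π ⊗ ρ)(t)‖`. -/
def MinTensor : Type (u + 1) := (algToSpatial A B).range.topologicalClosure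

namespace MinTensor

instance : CStarAlgebra (MinTensor A B) :=
  haveI : IsClosed ((algToSpatial A B).range.topologicalClosure : Set (Spatial A B)) :=
    StarSubalgebra.isClosed_topologicalClosure _
  inferInstanceAs (CStarAlgebra (algToSpatial A B).range.topologicalClosure)

variable (A B) in
/-- The inclusion of the minimal tensor product into `∏ B(H_π ⊗ H_ρ)`. -/
def val : MinTensor A B →⋆ₐ[ℂ] Spatial A B :=
  (algToSpatial A B).range.topologicalClosure.subtype

theorem val_injective : Function.Injective (val A B) := Subtype.val_injective

variable (A B) in
/-- The canonical map of the algebraic tensor product into the minimal tensor product. -/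
def ofAlg : A ⊗[ℂ] B →⋆ₐ[ℂ] MinTensor A B :=
  (algToSpatial A B).codRestrict (algToSpatial A B).range.topologicalClosure
    fun t => StarSubalgebra.le_topologicalClosure _ ⟨t, rfl⟩

/-- The elementary tensor `a ⊗ b`. -/
def tmul (a : A) (b : B) : MinTensor A B := ofAlg A B (a ⊗ₜ b)

/-- The representation `π ⊗ ρ` of the minimal tensor product on `H_π ⊗ H_ρ`. -/
def rep (p : CStarRep A) (q : CStarRep B) :
    MinTensor A B →⋆ₐ[ℂ] (HTensor p.H q.H →L[ℂ] HTensor p.H q.H) :=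
  (CStarProd.eval _ (p, q)).comp (val A B)

@[simp] theorem rep_tmul (p : CStarRep A) (q : CStarRep B) (a : A) (b : B) :
    rep p q (tmul a b) = HTensor.map (p.π a) (q.π b) :=
  algRep_tmul p q a b

variable (A B) in
/-- The flip, `a ⊗ b ↦ b ⊗ a`. -/
def flip : MinTensor A B →⋆ₐ[ℂ] Spatial B A :=
  CStarProd.lift (fun p => (HTensor.comm p.2.H p.1.H).conjStarAlgEquiv.toStarAlgHom.comp
    (rep p.2 p.1)) fun t => ⟨‖t‖, fun p => NonUnitalStarAlgHom.norm_apply_le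
      ((HTensor.comm p.2.H p.1.H).conjStarAlgEquiv.toStarAlgHom.comp (rep p.2 p.1)) t⟩

theorem flip_tmul (a : A) (b : B) : flip A B (tmul a b) = val B A (tmul b a) := by
  refine CStarProd.ext fun p => HTensor.ext_tmul fun x y => ?_
  change HTensor.comm p.2.H p.1.H
    (rep p.2 p.1 (tmul a b) ((HTensor.comm p.2.H p.1.H).symm (HTensor.tmul x y))) =
      rep p.1 p.2 (tmul b a) (HTensor.tmul x y)
  rw [← HTensor.comm_tmul y x, LinearIsometryEquiv.symm_apply_apply]
  simp

end MinTensor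

/-- The representation `(π ⊗ ρ) ∘ Φ` of `C`, for a ⋆-homomorphism `Φ : C → A ⊗ B`. -/
def CStarRep.along (Φ : C →⋆ₐ[ℂ] MinTensor A B) (p : CStarRep A) (q : CStarRep B) :
    CStarRep C where
  H := HTensor p.H q.H
  π := (MinTensor.rep p q).comp Φ

/-- `Φ ⊗ id`, as a map from `A ⊗ A` into `∏ B(H_π ⊗ (H_ρ ⊗ H_σ)) ⊇ A ⊗ A ⊗ A`, for a
⋆-homomorphism `Φ : A → A ⊗ A`: its coordinate at `(π, ρ, σ)` is `((π ⊗ ρ) ∘ Φ) ⊗ σ`. -/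
def comulTensorId (Φ : A →⋆ₐ[ℂ] MinTensor A A) : MinTensor A A →⋆ₐ[ℂ] Spatial₃ A A A :=
  CStarProd.lift
    (fun p => (HTensor.assoc p.1.H p.2.1.H p.2.2.H).conjStarAlgEquiv.toStarAlgHom.comp
      (MinTensor.rep (CStarRep.along Φ p.1 p.2.1) p.2.2))
    fun t => ⟨‖t‖, fun p => NonUnitalStarAlgHom.norm_apply_le
      ((HTensor.assoc p.1.H p.2.1.H p.2.2.H).conjStarAlgEquiv.toStarAlgHom.comp
        (MinTensor.rep (CStarRep.along Φ p.1 p.2.1) p.2.2)) t⟩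

/-- `id ⊗ Φ`, as a map from `A ⊗ A` into `∏ B(H_π ⊗ (H_ρ ⊗ H_σ)) ⊇ A ⊗ A ⊗ A`, for a
⋆-homomorphism `Φ : A → A ⊗ A`: its coordinate at `(π, ρ, σ)` is `π ⊗ ((ρ ⊗ σ) ∘ Φ)`. -/
def idTensorComul (Φ : A →⋆ₐ[ℂ] MinTensor A A) : MinTensor A A →⋆ₐ[ℂ] Spatial₃ A A A :=
  CStarProd.lift (fun p => MinTensor.rep p.1 (CStarRep.along Φ p.2.1 p.2.2))
    fun t => ⟨‖t‖, fun p => NonUnitalStarAlgHom.norm_apply_le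
      (MinTensor.rep p.1 (CStarRep.along Φ p.2.1 p.2.2)) t⟩

/-- On elementary tensors, `Φ ⊗ id` is `a ⊗ b ↦ Φ(a) ⊗ b`. -/
theorem comulTensorId_tmul (Φ : A →⋆ₐ[ℂ] MinTensor A A) (a b : A)
    (p : CStarRep A × CStarRep A × CStarRep A) :
    CStarProd.eval _ p (comulTensorId Φ (MinTensor.tmul a b)) =
      (HTensor.assoc p.1.H p.2.1.H p.2.2.H).conjStarAlgEquiv
        (HTensor.map (MinTensor.rep p.1 p.2.1 (Φ a)) (p.2.2.π b)) :=
  congrArg (HTensor.assoc p.1.H p.2.1.H p.2.2.H).conjStarAlgEquiv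
    (MinTensor.rep_tmul (CStarRep.along Φ p.1 p.2.1) p.2.2 a b)

/-- On elementary tensors, `id ⊗ Φ` is `a ⊗ b ↦ a ⊗ Φ(b)`. -/
theorem idTensorComul_tmul (Φ : A →⋆ₐ[ℂ] MinTensor A A) (a b : A)
    (p : CStarRep A × CStarRep A × CStarRep A) :
    CStarProd.eval _ p (idTensorComul Φ (MinTensor.tmul a b)) =
      HTensor.map (p.1.π a) (MinTensor.rep p.2.1 p.2.2 (Φ b)) :=
  MinTensor.rep_tmul p.1 (CStarRep.along Φ p.2.1 p.2.2) a b

end MinTensor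

/-! ## Compact quantum groups -/

/-- A compact quantum group in the sense of Woronowicz with function algebra `A`: a coassociative
unital ⋆-homomorphism `Δ : A → A ⊗ A` into the minimal tensor product such that `Δ(A)(1 ⊗ A)` and
`Δ(A)(A ⊗ 1)` span dense subspaces of `A ⊗ A`. -/
structure CompactQuantumGroup (A : Type u) [CStarAlgebra A] where
  Δ : A →⋆ₐ[ℂ] MinTensor A A
  coassoc : ∀ a, comulTensorId Δ (Δ a) = idTensorComul Δ (Δ a)
  dense_one_tmul : Dense (Submodule.span ℂ
    {t : MinTensor A A | ∃ a b, t = Δ a * MinTensor.tmul 1 b} : Set (MinTensor A A))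
  dense_tmul_one : Dense (Submodule.span ℂ
    {t : MinTensor A A | ∃ a b, t = Δ a * MinTensor.tmul b 1} : Set (MinTensor A A))

namespace CompactQuantumGroup

variable {A : Type u} [CStarAlgebra A] (G : CompactQuantumGroup A)

/-- `G` is cocommutative: `Δ` is invariant under the flip of `A ⊗ A`. -/
def IsCocommutative : Prop :=
  ∀ a, MinTensor.flip A A (G.Δ a) = MinTensor.val A A (G.Δ a)

/-- An `n`-dimensional unitary representation of `G`: a unitary matrix `u ∈ Mₙ(A)` with
`Δ(uᵢⱼ) = ∑ₖ uᵢₖ ⊗ uₖⱼ`. -/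
structure IsUnitaryRep {n : ℕ} (u : Matrix (Fin n) (Fin n) A) : Prop where
  unitary : u ∈ unitary (Matrix (Fin n) (Fin n) A)
  comul : ∀ i j, G.Δ (u i j) = ∑ k, MinTensor.tmul (u i k) (u k j)

/-- The dense Hopf ⋆-algebra of `G`: the span of the matrix coefficients of the finite-dimensional
unitary representations of `G`. -/
def polynomials : Submodule ℂ A :=
  Submodule.span ℂ {a | ∃ (n : ℕ) (u : Matrix (Fin n) (Fin n) A) (i j : Fin n),
    G.IsUnitaryRep u ∧ a = u i j}

/-- `B` is a Hopf ⋆-subalgebra of the dense Hopf ⋆-algebra of `G`: a unital ⋆-subalgebra of it, with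
`Δ(B) ⊆ B ⊗ B` (algebraic tensor product), which is a Hopf algebra for this restricted
comultiplication. (Its counit and antipode, unique if they exist, are then restrictions of those of
the dense Hopf ⋆-algebra.) -/
structure IsHopfStarSubalgebra (B : StarSubalgebra ℂ A) : Prop where
  le_polynomials : ∀ b ∈ B, b ∈ G.polynomials
  hopf : ∃ (δ : B →ₗ[ℂ] B ⊗[ℂ] B) (ε : B →ₐ[ℂ] ℂ) (S : B →ₗ[ℂ] B),
    (∀ b : B, MinTensor.ofAlg A A
      (TensorProduct.map B.subtype.toLinearMap B.subtype.toLinearMap (δ b)) = G.Δ b) ∧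
    (∀ b : B, TensorProduct.lid ℂ B (TensorProduct.map ε.toLinearMap LinearMap.id (δ b)) = b) ∧
    (∀ b : B, TensorProduct.rid ℂ B (TensorProduct.map LinearMap.id ε.toLinearMap (δ b)) = b) ∧
    (∀ b : B, LinearMap.mul' ℂ B (TensorProduct.map S LinearMap.id (δ b)) =
      algebraMap ℂ B (ε b)) ∧
    (∀ b : B, LinearMap.mul' ℂ B (TensorProduct.map LinearMap.id S (δ b)) =
      algebraMap ℂ B (ε b))

/-- `G` is connected: its dense Hopf ⋆-algebra has no finite-dimensional Hopf ⋆-subalgebra other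
than the scalars. -/
def IsConnected : Prop :=
  ∀ B : StarSubalgebra ℂ A, G.IsHopfStarSubalgebra B → FiniteDimensional ℂ B → B = ⊥

end CompactQuantumGroup

end

/-! Cocommutativity diagonalizes `u` over the scalars. Writing `u` on the left and on the right leg
of `A ⊗ A`, the two products have entries `Δ(uᵢⱼ)` and its flip, so the two copies of `u` commute.
Applying vector functionals yields scalar matrices that commute with each other and with all
adjoints. These have a spanning set of joint eigenvectors, and each nonzero one satisfies `u v = v
g` with `g` a group-like unitary. Since `u ≠ 1`, some such `g` is not `1`
(`exists_eigenvector_ne_one`).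

The spectrum of a group-like `g` is closed under multiplication: eigenvectors for `z` and `w` in two
representations tensor to an eigenvector for `z * w` in the representation `(π ⊗ ρ) ∘ Δ`. As a
closed multiplicative subset of the circle it is a closed subgroup, hence the circle or a set of
`m`-th roots of unity. In the second case `g ^ m = 1`, so the powers of `g` span a
finite-dimensional Hopf ⋆-subalgebra. Connectedness makes `g` a scalar, and `1` lies in its
spectrum, so `g = 1`, a contradiction (`IsGroupLike.sphere_subset_spectrum`).

Finally, a left inverse of `z - u` would compress along `v` to a left inverse of `z - g`, which the
eigenvectors of `g` exclude. Hence the spectrum of `u` contains that of `g`, which is the circle;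
unitarity gives the other inclusion. -/

noncomputable section

/-! ### States, GNS representations and eigenvectors for spectral values -/

section StatesAndRepresentations

variable {A : Type u} [CStarAlgebra A]

/-- By the C⋆-identity, since `(b - it)⋆(b - it) = b² + t²`. Letting `t` vary later forces states to
be real on self-adjoint elements. -/
theorem IsSelfAdjoint.norm_sub_smul_I_sq_le {b : A} (hb : IsSelfAdjoint b) (t : ℝ) :
    ‖b - (t * Complex.I) • (1 : A)‖ ^ 2 ≤ ‖b‖ ^ 2 + t ^ 2 := by
  rcases subsingleton_or_nontrivial A with h | h
  · rw [Subsingleton.elim (b - (t * Complex.I) • (1 : A)) 0, norm_zero]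
    exact (zero_pow two_ne_zero).trans_le (by positivity)
  have h1 : star (b - (t * Complex.I) • (1 : A)) * (b - (t * Complex.I) • (1 : A)) =
      b * b + ((t ^ 2 : ℝ) : ℂ) • (1 : A) := by
    have : star ((t * Complex.I) • (1 : A)) = -((t * Complex.I) • (1 : A)) := by
      rw [star_smul, star_one, ← neg_smul]
      simp
    rw [star_sub, this, hb.star_eq, sub_neg_eq_add, add_mul, mul_sub, mul_sub]
    have h2 : (t * Complex.I) • (1 : A) * (t * Complex.I) • (1 : A) =
        -(((t ^ 2 : ℝ) : ℂ) • (1 : A)) := by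
      rw [smul_mul_smul_comm, one_mul, ← neg_smul]
      congr 1
      push_cast
      linear_combination (t : ℂ) ^ 2 * Complex.I_mul_I
    rw [h2, smul_mul_assoc, one_mul, mul_smul_comm, mul_one]
    abel
  rw [sq, ← CStarRing.norm_star_mul_self, h1]
  refine (norm_add_le _ _).trans (add_le_add ((norm_mul_le _ _).trans_eq (sq _).symm) ?_)
  rw [norm_smul, CStarRing.norm_one, mul_one, Complex.norm_real, Real.norm_of_nonneg (sq_nonneg t)]

open scoped ComplexOrder in
/-- A contractive functional with value `1` at the unit is positive. -/
theorem StrongDual.nonneg_of_norm_le_one [PartialOrder A] [StarOrderedRing A]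
    (φ : StrongDual ℂ A) (h1 : φ 1 = 1) (hφ : ‖φ‖ ≤ 1) {a : A} (ha : 0 ≤ a) : 0 ≤ φ a := by
  -- The midpoint of `[0, ‖a‖]`: recentring there gives `‖a - r‖ ≤ r`, so `φ a` lies within `r` of
  -- `r`.
  obtain ⟨r, hr⟩ : ∃ r : ℝ, r = ‖a‖ / 2 := ⟨_, rfl⟩
  have hr0 : 0 ≤ r := by rw [hr]; positivity
  have hsa : IsSelfAdjoint a := IsSelfAdjoint.of_nonneg ha
  have hb : IsSelfAdjoint (a - algebraMap ℝ A r) := hsa.sub (IsSelfAdjoint.algebraMap A (.all r))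
  have : Nontrivial A := by
    by_contra h
    rw [not_nontrivial_iff_subsingleton] at h
    rw [Subsingleton.elim (1 : A) 0, map_zero] at h1
    exact zero_ne_one h1
  have hbs : ∀ t ∈ spectrum ℝ (a - algebraMap ℝ A r), -r ≤ t ∧ t ≤ r := by
    intro t ht
    rw [sub_eq_neg_add, ← spectrum.add_mem_iff] at ht
    have h2 := spectrum_nonneg_of_nonneg ha ht
    have h3 := (Real.le_norm_self _).trans (spectrum.norm_le_norm_of_mem ht)
    constructor <;> linarith
  have hbn : ‖a - algebraMap ℝ A r‖ ≤ r := by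
    rcases CStarAlgebra.norm_or_neg_norm_mem_spectrum hb with h | h
    · exact (hbs _ h).2
    · linarith [(hbs _ h).1]
  have key : ∀ t : ℝ, ((φ a).re - r) ^ 2 + ((φ a).im - t) ^ 2 ≤ r ^ 2 + t ^ 2 := by
    intro t
    have h3 := hb.norm_sub_smul_I_sq_le t
    have h4 : φ (a - algebraMap ℝ A r - (t * Complex.I) • (1 : A)) =
        φ a - r - t * Complex.I := by
      rw [map_sub, map_sub, map_smul, h1, Algebra.algebraMap_eq_smul_one,
        ← Complex.coe_smul, map_smul, h1]
      simp
    have h5 : ‖φ a - r - t * Complex.I‖ ≤ ‖a - algebraMap ℝ A r - (t * Complex.I) • (1 : A)‖ := by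
      rw [← h4]
      exact (φ.le_opNorm _).trans (mul_le_of_le_one_left (norm_nonneg _) hφ)
    have h6 : ‖φ a - r - t * Complex.I‖ ^ 2 = ((φ a).re - r) ^ 2 + ((φ a).im - t) ^ 2 := by
      rw [← Complex.normSq_eq_norm_sq, Complex.normSq_apply]
      simp
      ring
    rw [← h6]
    refine (pow_le_pow_left₀ (norm_nonneg _) h5 2).trans (h3.trans ?_)
    gcongr
  have him : (φ a).im = 0 := by
    by_contra h
    -- Expanding `key` leaves `im² - 2 t im ≤ r²`; this `t` makes `-2 t im = r² + 1`.
    have := key (-(r ^ 2 + 1) / (2 * (φ a).im))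
    have h7 : 2 * (φ a).im * (-(r ^ 2 + 1) / (2 * (φ a).im)) = -(r ^ 2 + 1) := by
      field_simp
    nlinarith [sq_nonneg ((φ a).re - r), sq_nonneg (φ a).im]
  have h0 := key 0
  rw [him] at h0
  rw [Complex.nonneg_iff]
  refine ⟨?_, him.symm⟩
  by_contra h
  push Not at h
  nlinarith [sq_nonneg (φ a).re, mul_nonneg_of_nonpos_of_nonpos h.le (neg_nonpos.2 hr0)]

open scoped ComplexOrder in
/-- The GNS representation of a positive functional with value `1` at the unit. -/
theorem StrongDual.exists_cstarRep (φ : StrongDual ℂ A) (h1 : φ 1 = 1) (hφ : ‖φ‖ ≤ 1) :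
    ∃ (p : CStarRep A) (ξ : p.H), ‖ξ‖ = 1 ∧ ∀ a, ((‖p.π a ξ‖ ^ 2 : ℝ) : ℂ) = φ (star a * a) := by
  let _ : PartialOrder A := CStarAlgebra.spectralOrder A
  have : StarOrderedRing A := CStarAlgebra.spectralOrderedRing A
  let f : A →ₚ[ℂ] ℂ := PositiveLinearMap.mk₀ φ.toLinearMap
    fun a ha => StrongDual.nonneg_of_norm_le_one φ h1 hφ ha
  have hf : ∀ a, f a = φ a := fun a => rfl
  have key : ∀ a, ((‖(f.gnsStarAlgHom a) (f.toPreGNS 1 : f.GNS)‖ ^ 2 : ℝ) : ℂ) =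
      φ (star a * a) := by
    intro a
    have : (f.gnsStarAlgHom a) (f.toPreGNS 1 : f.GNS) = (f.toPreGNS a : f.GNS) := by
      simp
    rw [this, UniformSpace.Completion.norm_coe]
    have := f.preGNS_norm_sq (f.toPreGNS a)
    push_cast
    rw [this]
    rfl
  have hξ : ‖(f.toPreGNS 1 : f.GNS)‖ = 1 := by
    have := key 1
    rw [map_one, one_apply_eq_self, star_one, one_mul, h1] at this
    have h2 : ‖(f.toPreGNS 1 : f.GNS)‖ ^ 2 = 1 := by exact_mod_cast this
    exact (pow_eq_one_iff_of_nonneg (norm_nonneg _) two_ne_zero).1 h2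
  have : Nontrivial f.GNS := ⟨⟨(f.toPreGNS 1 : f.GNS), 0, by
    rw [← norm_ne_zero_iff, hξ]; exact one_ne_zero⟩⟩
  exact ⟨⟨f.GNS, f.gnsStarAlgHom⟩, (f.toPreGNS 1 : f.GNS), hξ, key⟩

/-- Every spectral value of a normal element is an eigenvalue in some representation. -/
theorem exists_cstarRep_eigenvector (x : A) [IsStarNormal x] {z : ℂ} (hz : z ∈ spectrum ℂ x) :
    ∃ (p : CStarRep A) (ξ : p.H), ‖ξ‖ = 1 ∧ p.π x ξ = z • ξ := by
  have : Nontrivial A := by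
    by_contra h
    rw [not_nontrivial_iff_subsingleton] at h
    simp at hz
  -- By spectral permanence `z` is a spectral value in the commutative algebra generated by `x`,
  -- hence a character value. Hahn–Banach extends that character to a state of `A`.
  have hz' := (StarSubalgebra.spectrum_eq (hS := StarAlgebra.elemental.isClosed ℂ x)
      (a := ⟨x, StarAlgebra.elemental.self_mem ℂ x⟩) ▸ hz)
  rw [WeakDual.CharacterSpace.mem_spectrum_iff_exists] at hz'
  obtain ⟨χ, hχ⟩ := hz'
  obtain ⟨φ, hφ, hn⟩ := exists_extension_norm_eq
    (Subalgebra.toSubmodule (StarAlgebra.elemental ℂ x).toSubalgebra)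
    (WeakDual.toStrongDual (χ : WeakDual ℂ (StarAlgebra.elemental ℂ x)))
  have hφ' : ∀ y : StarAlgebra.elemental ℂ x, φ y = χ y := hφ
  have h1 : φ 1 = 1 := by
    have := hφ' 1
    rwa [map_one] at this
  have hn1 : ‖φ‖ ≤ 1 := by
    rw [hn]
    exact (WeakDual.CharacterSpace.norm_le_norm_one χ).trans_eq CStarRing.norm_one
  obtain ⟨p, ξ, hξ, hp⟩ := StrongDual.exists_cstarRep φ h1 hn1
  refine ⟨p, ξ, hξ, ?_⟩
  -- In the GNS space `‖(π(x) - z)ξ‖²` is the state at `(x - z)⋆(x - z)`, which vanishes because the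
  -- state is multiplicative on the generated subalgebra.
  have h2 := hp (x - algebraMap ℂ A z)
  have h3 := hφ' (star (⟨x, StarAlgebra.elemental.self_mem ℂ x⟩ -
    algebraMap ℂ (StarAlgebra.elemental ℂ x) z) *
    (⟨x, StarAlgebra.elemental.self_mem ℂ x⟩ - algebraMap ℂ (StarAlgebra.elemental ℂ x) z))
  rw [map_mul, map_sub χ, hχ, AlgHomClass.commutes] at h3
  have h4 : φ (star (x - algebraMap ℂ A z) * (x - algebraMap ℂ A z)) = 0 :=
    h3.trans (by simp)
  rw [h4, Complex.ofReal_eq_zero, sq_eq_zero_iff, norm_eq_zero, map_sub, AlgHomClass.commutes,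
    sub_apply, sub_eq_zero] at h2
  rw [h2, Algebra.algebraMap_eq_smul_one]
  rfl

/-- The representations separate the points. -/
theorem eq_zero_of_forall_cstarRep {a : A} (h : ∀ p : CStarRep A, p.π a = 0) : a = 0 := by
  by_contra ha
  have : Nontrivial A := ⟨⟨a, 0, ha⟩⟩
  have hsa : IsSelfAdjoint (star a * a) := IsSelfAdjoint.star_mul_self a
  have : IsStarNormal (star a * a) := hsa.isStarNormal
  obtain ⟨z, hz, hz0⟩ : ∃ z ∈ spectrum ℂ (star a * a), z ≠ 0 := by
    by_contra! hz
    have h1 := hsa.spectralRadius_eq_nnnorm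
    have h2 : spectralRadius ℂ (star a * a) = 0 := by
      simp only [spectralRadius, ENNReal.iSup_eq_zero]
      intro z hz'
      simp [hz z hz']
    rw [h2] at h1
    have h3 : star a * a = 0 := by simpa using h1.symm
    exact ha (CStarRing.star_mul_self_eq_zero_iff a |>.1 h3)
  obtain ⟨p, ξ, hξ, hp⟩ := exists_cstarRep_eigenvector (star a * a) hz
  rw [map_mul, h p, mul_zero, zero_apply] at hp
  rcases smul_eq_zero.1 hp.symm with h0 | h0
  · exact hz0 h0
  · simp [h0] at hξ

theorem eq_of_forall_inner_cstarRep {a b : A}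
    (h : ∀ (p : CStarRep A) (ξ η : p.H), ⟪η, p.π a ξ⟫_ℂ = ⟪η, p.π b ξ⟫_ℂ) : a = b := by
  rw [← sub_eq_zero]
  refine eq_zero_of_forall_cstarRep fun p => ?_
  ext ξ
  refine ext_inner_left ℂ fun η => ?_
  rw [map_sub, sub_apply, inner_sub_right, h, sub_self]
  simp

/-- An element with an eigenvector in some representation is not left invertible after
subtracting the eigenvalue. -/
theorem not_left_inverse_of_eigenvector {x w : A} {z : ℂ} (p : CStarRep A) {ξ : p.H}
    (hξ : ‖ξ‖ = 1) (h : p.π x ξ = z • ξ) : w * (algebraMap ℂ A z - x) ≠ 1 := by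
  intro hw
  have h1 : p.π (algebraMap ℂ A z - x) ξ = 0 := by
    rw [map_sub, AlgHomClass.commutes, sub_apply, h,
      Algebra.algebraMap_eq_smul_one]
    simp
  have h2 : p.π (w * (algebraMap ℂ A z - x)) ξ = 0 := by
    rw [map_mul, mul_apply_eq_comp, h1, map_zero]
  rw [hw, map_one, one_apply_eq_self] at h2
  simp [h2] at hξ

theorem mem_spectrum_of_eigenvector {x : A} {z : ℂ} (p : CStarRep A) {ξ : p.H}
    (hξ : ‖ξ‖ = 1) (h : p.π x ξ = z • ξ) : z ∈ spectrum ℂ x := by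
  rw [spectrum.mem_iff]
  intro hu
  obtain ⟨w, hw⟩ := hu.exists_left_inv
  exact not_left_inverse_of_eigenvector p hξ h hw

end StatesAndRepresentations

/-! ### Closed subsemigroups of compact groups and closed subgroups of the circle -/

section CircleSubgroups

/-- A nonempty closed multiplicatively closed subset of a compact group is a subgroup. -/
theorem zpow_mem_of_isClosed_of_mul_mem {K : Type*} [Group K] [TopologicalSpace K]
    [CompactSpace K] [IsTopologicalGroup K] {S : Set K} (hc : IsClosed S)
    (hm : ∀ x ∈ S, ∀ y ∈ S, x * y ∈ S) {x : K} (hx : x ∈ S) (m : ℤ) : x ^ m ∈ S := by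
  have hpow : ∀ n : ℕ, x ^ (n + 1) ∈ S := by
    intro n
    induction n with
    | zero => simpa using hx
    | succ n ih => rw [pow_succ]; exact hm _ ih _ hx
  refine hc.mem_of_frequently_of_tendsto (f := id) (b := nhds (x ^ m)) ?_ Filter.tendsto_id
  rw [Filter.frequently_iff]
  intro U hU
  -- In a compact group the positive powers of `x` cluster at every integer power. The bound `1 ≤ n`
  -- matters: `x ^ 0` is not yet known to lie in `S`.
  obtain ⟨n, hn, hU'⟩ := Filter.frequently_atTop.1
    ((mapClusterPt_iff_frequently.1 (mapClusterPt_self_zpow_atTop_pow x m)) U hU) 1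
  obtain ⟨k, rfl⟩ := Nat.exists_eq_add_of_le' hn
  exact ⟨_, hU', hpow k⟩

/-- A closed subgroup of the circle is the whole circle or has finite exponent. -/
theorem Circle.eq_univ_or_exists_pow_eq_one (K : Subgroup Circle) (hK : IsClosed (K : Set Circle)) :
    (∀ z, z ∈ K) ∨ ∃ m : ℕ, 0 < m ∧ ∀ z ∈ K, z ^ m = 1 := by
  let H : AddSubgroup ℝ := K.toAddSubgroup.comap Circle.expHom
  have hH : ∀ t, t ∈ H ↔ Circle.exp t ∈ K := fun t => Iff.rfl
  have hexp : ∀ z : Circle, ∃ t : ℝ, Circle.exp t = z := fun z => ⟨_, Circle.exp_arg z⟩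
  rcases H.dense_or_cyclic with hd | ⟨a, ha⟩
  · left
    have hcl : IsClosed (H : Set ℝ) := hK.preimage Circle.exp.continuous
    intro z
    obtain ⟨t, rfl⟩ := hexp z
    rw [← hH, ← SetLike.mem_coe, ← hcl.closure_eq]
    exact hd t
  · right
    -- The kernel of `exp` lies in `H`, so `2π = k • a` with `k ≠ 0`, and `|k|` is an exponent.
    have h2 : 2 * Real.pi ∈ H := by
      rw [hH, Circle.exp_two_pi]
      exact one_mem K
    rw [ha, AddSubgroup.mem_closure_singleton] at h2
    obtain ⟨k, hk⟩ := h2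
    have hk0 : k ≠ 0 := by
      rintro rfl
      rw [zero_smul] at hk
      exact Real.two_pi_pos.ne hk
    refine ⟨k.natAbs, Int.natAbs_pos.2 hk0, fun z hz => ?_⟩
    obtain ⟨t, rfl⟩ := hexp z
    rw [← hH, ha, AddSubgroup.mem_closure_singleton] at hz
    obtain ⟨j, rfl⟩ := hz
    have h3 : Circle.exp (j • a) ^ k = 1 := by
      rw [← Circle.exp_zsmul, smul_comm, hk, Circle.exp_zsmul, Circle.exp_two_pi, one_zpow]
    rcases Int.natAbs_eq k with h | h
    · rw [← zpow_natCast, ← h, h3]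
    · rw [← zpow_natCast, ← inv_inj, ← zpow_neg, ← h, h3, inv_one]

end CircleSubgroups

/-! ### Group-like unitaries and their spectra -/

namespace CompactQuantumGroup

variable {A : Type u} [CStarAlgebra A] (G : CompactQuantumGroup A)

/-- A unitary `g` with `Δ(g) = g ⊗ g`. -/
structure IsGroupLike (g : A) : Prop where
  mem_unitary : g ∈ unitary A
  comul : G.Δ g = MinTensor.tmul g g

variable {G}

/-- If `π(g) ξ = z ξ` and `ρ(g) η = w η`, then `ξ ⊗ η` is an eigenvector of `(π ⊗ ρ)(Δ g) = π(g) ⊗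
ρ(g)` with eigenvalue `z * w`. -/
theorem IsGroupLike.spectrum_mul_mem {g : A} (hg : G.IsGroupLike g) {z w : ℂ}
    (hz : z ∈ spectrum ℂ g) (hw : w ∈ spectrum ℂ g) : z * w ∈ spectrum ℂ g := by
  have : IsStarNormal g := isStarNormal_of_mem_unitary hg.mem_unitary
  obtain ⟨p, ξ, hξ, hp⟩ := exists_cstarRep_eigenvector g hz
  obtain ⟨q, η, hη, hq⟩ := exists_cstarRep_eigenvector g hw
  refine mem_spectrum_of_eigenvector (CStarRep.along G.Δ p q) (ξ := HTensor.tmul ξ η) ?_ ?_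
  · exact (HTensor.norm_tmul ξ η).trans (by rw [hξ, hη, one_mul])
  · change MinTensor.rep p q (G.Δ g) (HTensor.tmul ξ η) = _
    rw [hg.comul, MinTensor.rep_tmul, HTensor.map_tmul, hp, hq, HTensor.tmul_smul_left,
      HTensor.tmul_smul_right, smul_smul]
    rfl

theorem isGroupLike_one : G.IsGroupLike 1 where
  mem_unitary := one_mem _
  comul := by
    rw [map_one, MinTensor.tmul, ← Algebra.TensorProduct.one_def, map_one]

theorem IsGroupLike.mul {g h : A} (hg : G.IsGroupLike g) (hh : G.IsGroupLike h) :
    G.IsGroupLike (g * h) where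
  mem_unitary := mul_mem hg.mem_unitary hh.mem_unitary
  comul := by
    rw [map_mul, hg.comul, hh.comul, MinTensor.tmul, MinTensor.tmul, MinTensor.tmul, ← map_mul,
      Algebra.TensorProduct.tmul_mul_tmul]

theorem IsGroupLike.star {g : A} (hg : G.IsGroupLike g) : G.IsGroupLike (star g) where
  mem_unitary := Unitary.star_mem hg.mem_unitary
  comul := by
    rw [map_star, hg.comul, MinTensor.tmul, MinTensor.tmul, ← map_star, TensorProduct.star_tmul]

variable (G) in
/-- The group of group-like unitaries. -/
def groupLikes : Subgroup (unitary A) where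
  carrier := {g | G.IsGroupLike g}
  one_mem' := isGroupLike_one
  mul_mem' hg hh := hg.mul hh
  inv_mem' hg := hg.star

theorem IsGroupLike.mem_polynomials {g : A} (hg : G.IsGroupLike g) : g ∈ G.polynomials := by
  refine Submodule.subset_span ⟨1, Matrix.of fun _ _ => g, 0, 0, ⟨?_, fun i j => ?_⟩, rfl⟩
  · rw [Unitary.mem_iff]
    constructor
    · ext i j
      simp [Matrix.mul_apply, Matrix.star_apply, (Unitary.mem_iff.1 hg.mem_unitary).1,
        Subsingleton.elim i j, Matrix.one_apply]
    · ext i j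
      simp [Matrix.mul_apply, Matrix.star_apply, (Unitary.mem_iff.1 hg.mem_unitary).2,
        Subsingleton.elim i j, Matrix.one_apply]
  · simpa using hg.comul

/-- The spectrum of a group-like unitary contains `1`, and is the circle or consists of `m`-th roots
of unity for some `m`. -/
theorem spectrum_groupLike_cases {g : A} (hg : G.IsGroupLike g) (hne : (spectrum ℂ g).Nonempty) :
    (1 : ℂ) ∈ spectrum ℂ g ∧ (Metric.sphere (0 : ℂ) 1 ⊆ spectrum ℂ g ∨
      ∃ m : ℕ, 0 < m ∧ ∀ z ∈ spectrum ℂ g, z ^ m = 1) := by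
  have : Nontrivial A := by
    by_contra h
    rw [not_nontrivial_iff_subsingleton] at h
    obtain ⟨z, hz⟩ := hne
    simp at hz
  have hsub := spectrum.subset_circle_of_unitary (𝕜 := ℂ) hg.mem_unitary
  let S : Set Circle := {z | (z : ℂ) ∈ spectrum ℂ g}
  have hSc : IsClosed S := (spectrum.isClosed (𝕜 := ℂ) g).preimage continuous_subtype_val
  have hSm : ∀ x ∈ S, ∀ y ∈ S, x * y ∈ S := fun x hx y hy => by
    have := hg.spectrum_mul_mem hx hy
    rwa [← Circle.coe_mul] at this
  have hlift : ∀ z ∈ spectrum ℂ g, ∃ x ∈ S, (x : ℂ) = z := fun z hz =>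
    ⟨⟨z, by simpa [Submonoid.unitSphere] using hsub hz⟩, hz, rfl⟩
  obtain ⟨z, hz⟩ := hne
  obtain ⟨x, hx, -⟩ := hlift z hz
  have h1 : (1 : Circle) ∈ S := by
    simpa using zpow_mem_of_isClosed_of_mul_mem hSc hSm hx 0
  let K : Subgroup Circle :=
    { carrier := S
      one_mem' := h1
      mul_mem' := fun hx hy => hSm _ hx _ hy
      inv_mem' := fun hx => by
        simpa using zpow_mem_of_isClosed_of_mul_mem hSc hSm hx (-1) }
  refine ⟨by simpa [S] using h1, ?_⟩
  rcases Circle.eq_univ_or_exists_pow_eq_one K hSc with h | ⟨m, hm, h⟩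
  · exact Or.inl fun z hz => h ⟨z, by simpa [Submonoid.unitSphere] using hz⟩
  · refine Or.inr ⟨m, hm, fun z hz => ?_⟩
    obtain ⟨y, hy, rfl⟩ := hlift z hz
    rw [← Circle.coe_pow, h y hy, Circle.coe_one]

theorem pow_eq_pow_of_spectrum {g : A} [IsStarNormal g] {k l : ℕ}
    (h : ∀ z ∈ spectrum ℂ g, z ^ k = z ^ l) : g ^ k = g ^ l := by
  rw [← cfc_pow_id (R := ℂ) g k, ← cfc_pow_id (R := ℂ) g l]
  exact cfc_congr h

end CompactQuantumGroup

/-! ### The Hopf ⋆-subalgebra spanned by the powers of a group-like unitary -/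

namespace CompactQuantumGroup

variable {A : Type u} [CStarAlgebra A] {G : CompactQuantumGroup A}

/-- The map of the group algebra of the cyclic group generated by a unitary into the algebra. -/
def zpowersAlgHom (g : unitary A) : MonoidAlgebra ℂ (Subgroup.zpowers g) →ₐ[ℂ] A :=
  MonoidAlgebra.lift ℂ A (Subgroup.zpowers g)
    ((unitary A).subtype.comp (Subgroup.zpowers g).subtype)

@[simp]
theorem zpowersAlgHom_single (g : unitary A) (γ : Subgroup.zpowers g) (c : ℂ) :
    zpowersAlgHom g (MonoidAlgebra.single γ c) = c • ((γ : unitary A) : A) := by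
  simp [zpowersAlgHom]

/-- Dedekind independence of characters: the spectrum is a monoid `K`, the power `g ^ k` corresponds
to the character `z ↦ z ^ k` of `K`, and distinct powers give distinct characters by functional
calculus. A linear relation among powers, evaluated on eigenvectors, is a relation among these
characters. -/
theorem IsGroupLike.zpowersAlgHom_injective {g : unitary A} (hg : G.IsGroupLike (g : A))
    (hfin : IsOfFinOrder g) (h1 : (1 : ℂ) ∈ spectrum ℂ (g : A)) :
    Function.Injective (zpowersAlgHom g) := by
  have : IsStarNormal (g : A) := isStarNormal_of_mem_unitary hg.mem_unitary
  let K : Submonoid ℂ :=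
    { carrier := spectrum ℂ (g : A)
      one_mem' := h1
      mul_mem' := hg.spectrum_mul_mem }
  -- Finite order allows natural exponents, which is needed because `K` is only a monoid.
  have hk : ∀ γ : Subgroup.zpowers g, ∃ k : ℕ, g ^ k = γ := fun γ =>
    hfin.mem_powers_iff_mem_zpowers.2 γ.2
  choose k hk using hk
  let f : Subgroup.zpowers g → (K →* ℂ) := fun γ => K.subtype ^ k γ
  have hf : Function.Injective f := by
    intro γ δ h
    have h2 : (g : A) ^ k γ = (g : A) ^ k δ := pow_eq_pow_of_spectrum fun z hz =>
      DFunLike.congr_fun h (⟨z, hz⟩ : K)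
    rw [Subtype.ext_iff, ← hk, ← hk]
    exact Subtype.ext h2
  have hli := (linearIndependent_monoidHom K ℂ).comp f hf
  let T : MonoidAlgebra ℂ (Subgroup.zpowers g) →ₗ[ℂ] (K → ℂ) :=
    Finsupp.linearCombination ℂ ((fun φ : K →* ℂ => (φ : K → ℂ)) ∘ f) ∘ₗ
      (MonoidAlgebra.coeffLinearEquiv ℂ).toLinearMap
  rw [injective_iff_map_eq_zero]
  intro x hx
  have hT : T x = 0 := by
    funext z
    obtain ⟨p, ξ, hξ, hp⟩ := exists_cstarRep_eigenvector (g : A) z.2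
    have hpow : ∀ j : ℕ, (p.π (g : A) ^ j) ξ = (z : ℂ) ^ j • ξ := by
      intro j
      induction j with
      | zero => simp
      | succ j ih => rw [pow_succ', mul_apply_eq_comp, ih, map_smul, hp, smul_smul, pow_succ]
    have key : ∀ y, p.π (zpowersAlgHom g y) ξ = T y z • ξ := by
      intro y
      induction y using MonoidAlgebra.induction_linear with
      | zero => simp
      | add a b ha hb =>
        rw [map_add, map_add, add_apply, ha, hb, map_add, Pi.add_apply, add_smul]
      | single γ c =>
        rw [zpowersAlgHom_single, ← hk γ, map_smul, smul_apply, SubmonoidClass.coe_pow, map_pow,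
          hpow, smul_smul]
        simp [T, f]
    have h3 := key x
    rw [hx, map_zero, zero_apply] at h3
    refine (smul_eq_zero.1 h3.symm).resolve_right ?_
    rintro rfl
    simp at hξ
  have h4 := linearIndependent_iff.1 hli ((MonoidAlgebra.coeffLinearEquiv ℂ) x) hT
  simpa using h4

/-- The span of the powers of a unitary. -/
def zpowersStarSubalgebra (g : unitary A) : StarSubalgebra ℂ A :=
  { (zpowersAlgHom g).range with
    star_mem' := by
      rintro _ ⟨x, rfl⟩
      induction x using MonoidAlgebra.induction_linear with
      | zero => exact ⟨0, by simp⟩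
      | add a b ha hb =>
        obtain ⟨a', ha⟩ := ha
        obtain ⟨b', hb⟩ := hb
        refine ⟨a' + b', ?_⟩
        rw [map_add, map_add, star_add, ha, hb]
      | single γ c =>
        refine ⟨MonoidAlgebra.single γ⁻¹ (star c), ?_⟩
        change zpowersAlgHom g _ = star (zpowersAlgHom g _)
        rw [zpowersAlgHom_single, zpowersAlgHom_single, star_smul]
        rfl }

/-- Injectivity transports the Hopf structure of the group algebra; it is compatible with `Δ`
because every power of `g` is group-like. -/
theorem IsGroupLike.isHopfStarSubalgebra_zpowers {g : unitary A} (hg : G.IsGroupLike (g : A))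
    (hinj : Function.Injective (zpowersAlgHom g)) :
    G.IsHopfStarSubalgebra (zpowersStarSubalgebra g) := by
  have hmem : ∀ γ : Subgroup.zpowers g, G.IsGroupLike ((γ : unitary A) : A) := fun γ =>
    (Subgroup.zpowers_le (H := G.groupLikes)).2 hg γ.2
  constructor
  · rintro _ ⟨x, rfl⟩
    induction x using MonoidAlgebra.induction_linear with
    | zero => simp
    | add a b ha hb =>
      rw [map_add]
      exact add_mem ha hb
    | single γ c =>
      change zpowersAlgHom g _ ∈ _
      rw [zpowersAlgHom_single]
      exact Submodule.smul_mem _ _ (hmem γ).mem_polynomials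
  · let e : MonoidAlgebra ℂ (Subgroup.zpowers g) ≃ₐ[ℂ] zpowersStarSubalgebra g :=
      AlgEquiv.ofInjective (zpowersAlgHom g) hinj
    let δ : zpowersStarSubalgebra g →ₗ[ℂ] zpowersStarSubalgebra g ⊗[ℂ] zpowersStarSubalgebra g :=
      TensorProduct.map e.toLinearMap e.toLinearMap ∘ₗ Coalgebra.comul ∘ₗ e.symm.toLinearMap
    let ε : zpowersStarSubalgebra g →ₐ[ℂ] ℂ :=
      (Bialgebra.counitAlgHom ℂ (MonoidAlgebra ℂ (Subgroup.zpowers g))).comp e.symm.toAlgHom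
    let S : zpowersStarSubalgebra g →ₗ[ℂ] zpowersStarSubalgebra g :=
      e.toLinearMap ∘ₗ HopfAlgebra.antipode ℂ ∘ₗ e.symm.toLinearMap
    have hδ : ∀ γ c, δ (e (MonoidAlgebra.single γ c)) =
        c • (e (MonoidAlgebra.single γ 1) ⊗ₜ e (MonoidAlgebra.single γ 1)) := by
      intro γ c
      have h : e (MonoidAlgebra.single γ c) = c • e (MonoidAlgebra.single γ 1) := by
        rw [← map_smul]
        simp
      rw [← TensorProduct.tmul_smul, ← h]
      simp [δ]
    have hε : ∀ γ c, ε (e (MonoidAlgebra.single γ c)) = c := by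
      intro γ c
      simp [ε]
    have hS : ∀ γ c, S (e (MonoidAlgebra.single γ c)) = e (MonoidAlgebra.single γ⁻¹ c) := by
      intro γ c
      simp [S]
    have hind : ∀ P : zpowersStarSubalgebra g → Prop, P 0 →
      (∀ a b, P a → P b → P (a + b)) → (∀ γ c, P (e (MonoidAlgebra.single γ c))) → ∀ b, P b := by
      intro P h0 ha hs b
      obtain ⟨x, rfl⟩ := e.surjective b
      induction x using MonoidAlgebra.induction_linear with
      | zero => rwa [map_zero]
      | add a b h1 h2 =>
        rw [map_add]
        exact ha _ _ h1 h2
      | single γ c => exact hs γ c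
    refine ⟨δ, ε, S, ?_, ?_, ?_, ?_, ?_⟩ <;> refine hind _ ?_ ?_ ?_
    · simp
    · intro a b ha hb
      simp only [map_add, AddMemClass.coe_add, ha, hb]
    · intro γ c
      rw [hδ, map_smul, map_smul, TensorProduct.map_tmul]
      change c • MinTensor.tmul (zpowersAlgHom g _) (zpowersAlgHom g _) = G.Δ (zpowersAlgHom g _)
      rw [zpowersAlgHom_single, zpowersAlgHom_single, one_smul, map_smul, (hmem γ).comul]
    · simp
    · intro a b ha hb
      simp only [map_add, ha, hb]
    · intro γ c
      rw [hδ, map_smul, map_smul, TensorProduct.map_tmul]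
      simp [hε, ← map_smul]
    · simp
    · intro a b ha hb
      simp only [map_add, ha, hb]
    · intro γ c
      rw [hδ, map_smul, map_smul, TensorProduct.map_tmul]
      simp [hε, ← map_smul]
    · simp
    · intro a b ha hb
      simp only [map_add, ha, hb]
    · intro γ c
      rw [hδ, map_smul, map_smul, TensorProduct.map_tmul, hS, hε, LinearMap.mul'_apply,
        LinearMap.id_apply, ← map_mul, MonoidAlgebra.single_mul_single, inv_mul_cancel, mul_one,
        ← MonoidAlgebra.one_def, map_one, Algebra.algebraMap_eq_smul_one]
    · simp
    · intro a b ha hb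
      simp only [map_add, ha, hb]
    · intro γ c
      rw [hδ, map_smul, map_smul, TensorProduct.map_tmul, hS, hε, LinearMap.mul'_apply,
        LinearMap.id_apply, ← map_mul, MonoidAlgebra.single_mul_single, mul_inv_cancel, mul_one,
        ← MonoidAlgebra.one_def, map_one, Algebra.algebraMap_eq_smul_one]

/-- In a connected quantum group, the spectrum of a nontrivial group-like unitary is the circle. -/
theorem IsGroupLike.sphere_subset_spectrum (hconn : G.IsConnected) {g : A} (hg : G.IsGroupLike g)
    (hne : g ≠ 1) : Metric.sphere (0 : ℂ) 1 ⊆ spectrum ℂ g := by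
  have : Nontrivial A := ⟨⟨g, 1, hne⟩⟩
  obtain ⟨h1, h | ⟨m, hm, h⟩⟩ := spectrum_groupLike_cases hg (spectrum.nonempty g)
  · exact h
  exfalso
  have : IsStarNormal g := isStarNormal_of_mem_unitary hg.mem_unitary
  obtain ⟨v, rfl⟩ : ∃ v : unitary A, (v : A) = g := ⟨⟨g, hg.mem_unitary⟩, rfl⟩
  have hfin : IsOfFinOrder v := by
    refine isOfFinOrder_iff_pow_eq_one.2 ⟨m, hm, Subtype.ext ?_⟩
    have : (v : A) ^ m = (v : A) ^ 0 :=
      pow_eq_pow_of_spectrum fun z hz => by rw [h z hz, pow_zero]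
    rwa [pow_zero] at this
  have hB := hconn (zpowersStarSubalgebra v) (hg.isHopfStarSubalgebra_zpowers
    (hg.zpowersAlgHom_injective hfin h1)) (by
      have : Finite (Subgroup.zpowers v) := hfin.finite_zpowers
      have : Module.Finite ℂ (MonoidAlgebra ℂ (Subgroup.zpowers v)) :=
        Module.Finite.equiv (MonoidAlgebra.coeffLinearEquiv ℂ).symm
      exact Module.Finite.range (zpowersAlgHom v).toLinearMap)
  have hv : (v : A) ∈ zpowersStarSubalgebra v :=
    ⟨MonoidAlgebra.single ⟨v, Subgroup.mem_zpowers v⟩ 1, by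
      change zpowersAlgHom v _ = _
      rw [zpowersAlgHom_single, one_smul]⟩
  -- Connectedness makes the unitary a scalar `c`; its spectrum is `{c}` and contains `1`, so it
  -- equals `1`.
  rw [hB, StarSubalgebra.mem_bot] at hv
  obtain ⟨c, hc⟩ := hv
  rw [← hc, spectrum.scalar_eq, Set.mem_singleton_iff] at h1
  rw [← h1, map_one] at hc
  exact hne hc.symm

end CompactQuantumGroup

/-! ### Elementary tensors and product functionals -/

namespace MinTensor

variable {A : Type u} [CStarAlgebra A]

theorem tmul_sum_left {ι : Type*} (s : Finset ι) (f : ι → A) (b : A) :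
    tmul (∑ i ∈ s, f i) b = ∑ i ∈ s, tmul (f i) b := by
  simp only [tmul, TensorProduct.sum_tmul, map_sum]

theorem tmul_sum_right {ι : Type*} (s : Finset ι) (a : A) (f : ι → A) :
    tmul a (∑ i ∈ s, f i) = ∑ i ∈ s, tmul a (f i) := by
  simp only [tmul, TensorProduct.tmul_sum, map_sum]

theorem smul_tmul' (c : ℂ) (a b : A) : tmul (c • a) b = c • tmul a b := by
  simp only [tmul, ← TensorProduct.smul_tmul', map_smul]

theorem tmul_smul (c : ℂ) (a b : A) : tmul a (c • b) = c • tmul a b := by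
  simp only [tmul, TensorProduct.tmul_smul, map_smul]

theorem tmul_mul_tmul (a b c d : A) : tmul a b * tmul c d = tmul (a * c) (b * d) := by
  simp only [tmul, ← map_mul, Algebra.TensorProduct.tmul_mul_tmul]

variable (A) in
/-- `a ↦ a ⊗ 1`. -/
def left : A →⋆ₐ[ℂ] MinTensor A A :=
  (ofAlg A A).comp { (Algebra.TensorProduct.includeLeft : A →ₐ[ℂ] A ⊗[ℂ] A) with
    map_star' := fun a => by simp [TensorProduct.star_tmul] }

variable (A) in
/-- `b ↦ 1 ⊗ b`. -/
def right : A →⋆ₐ[ℂ] MinTensor A A :=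
  (ofAlg A A).comp { (Algebra.TensorProduct.includeRight : A →ₐ[ℂ] A ⊗[ℂ] A) with
    map_star' := fun a => by simp [TensorProduct.star_tmul] }

theorem left_mul_right (a b : A) : left A a * right A b = tmul a b := by
  change tmul a 1 * tmul 1 b = _
  rw [tmul_mul_tmul, one_mul, mul_one]

theorem right_mul_left (a b : A) : right A b * left A a = tmul a b := by
  change tmul 1 b * tmul a 1 = _
  rw [tmul_mul_tmul, one_mul, mul_one]

/-- The vector functionals of `p` and `q` on an elementary tensor. -/
theorem inner_rep_tmul (p q : CStarRep A) (ξ ξ' : p.H) (η η' : q.H) (a b : A) :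
    ⟪HTensor.tmul ξ' η', rep p q (tmul a b) (HTensor.tmul ξ η)⟫_ℂ =
      ⟪ξ', p.π a ξ⟫_ℂ * ⟪η', q.π b η⟫_ℂ := by
  rw [rep_tmul, HTensor.map_tmul, HTensor.inner_tmul]

end MinTensor

/-- A vector functional `a ↦ ⟪ξ', π(a) ξ⟫` of a representation. -/
structure VectorFunctional (A : Type u) [CStarAlgebra A] where
  p : CStarRep A
  ξ' : p.H
  ξ : p.H

namespace VectorFunctional

variable {A : Type u} [CStarAlgebra A]

/-- The underlying linear functional. -/
def lin (φ : VectorFunctional A) : A →ₗ[ℂ] ℂ where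
  toFun a := ⟪φ.ξ', φ.p.π a φ.ξ⟫_ℂ
  map_add' a b := by rw [map_add, add_apply, inner_add_right]
  map_smul' c a := by rw [map_smul, smul_apply, inner_smul_right]; rfl

/-- The functional `a ↦ conj (φ (a⋆))`. -/
def conj (φ : VectorFunctional A) : VectorFunctional A := ⟨φ.p, φ.ξ, φ.ξ'⟩

theorem conj_lin (φ : VectorFunctional A) (a : A) : φ.conj.lin a = star (φ.lin (star a)) := by
  change ⟪φ.ξ, φ.p.π a φ.ξ'⟫_ℂ = star ⟪φ.ξ', φ.p.π (star a) φ.ξ⟫_ℂ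
  rw [map_star, ContinuousLinearMap.star_eq_adjoint, ContinuousLinearMap.adjoint_inner_right]
  exact (inner_conj_symm _ _).symm

theorem ext_lin {a b : A} (h : ∀ φ : VectorFunctional A, φ.lin a = φ.lin b) : a = b :=
  eq_of_forall_inner_cstarRep fun p ξ η => h ⟨p, η, ξ⟩

/-- The functional `φ ⊗ ψ`. -/
def prod (φ ψ : VectorFunctional A) : MinTensor A A →ₗ[ℂ] ℂ where
  toFun t := ⟪HTensor.tmul φ.ξ' ψ.ξ', MinTensor.rep φ.p ψ.p t (HTensor.tmul φ.ξ ψ.ξ)⟫_ℂ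
  map_add' a b := by rw [map_add, add_apply, inner_add_right]
  map_smul' c a := by rw [map_smul, smul_apply, inner_smul_right]; rfl

theorem prod_tmul (φ ψ : VectorFunctional A) (a b : A) :
    φ.prod ψ (MinTensor.tmul a b) = φ.lin a * ψ.lin b :=
  MinTensor.inner_rep_tmul _ _ _ _ _ _ _ _

end VectorFunctional

/-! ### Joint diagonalization of commuting normal matrices -/

/-- Matrices that commute with each other and with the adjoints have spanning joint eigenvectors. -/
theorem Matrix.eq_top_of_joint_eigenvectors_mem {n ι : Type*} [Fintype n] [DecidableEq n]
    (X : ι → Matrix n n ℂ) (h : ∀ i j, Commute (X i) (X j))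
    (h' : ∀ i j, Commute (star (X i)) (X j)) (W : Submodule ℂ (n → ℂ))
    (hW : ∀ (v : n → ℂ) (c d : ι → ℂ), (∀ i, (X i).mulVec v = c i • v) →
      (∀ i, (star (X i)).mulVec v = d i • v) → v ∈ W) : W = ⊤ := by
  have h'' : ∀ i j, Commute (star (X i)) (star (X j)) := fun i j => (h i j).star_star
  -- Twice the real parts and, up to sign, twice the imaginary parts: a commuting Hermitian family,
  -- to which the spectral theorem applies. The eigenvalues of `X i` and its adjoint are recovered
  -- from `X + X⋆` and `X - X⋆`.
  let Y : ι ⊕ ι → Matrix n n ℂ := Sum.elim (fun i => X i + star (X i))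
    (fun i => Complex.I • (X i - star (X i)))
  have hY : ∀ k, (Y k).IsHermitian := by
    rintro (i | i)
    · change star (X i + star (X i)) = X i + star (X i)
      rw [star_add, star_star, add_comm]
    · change star (Complex.I • (X i - star (X i))) = Complex.I • (X i - star (X i))
      rw [star_smul, star_sub, star_star, ← neg_sub, smul_neg, ← neg_smul]
      simp
  have hp : ∀ i j, Commute (X i + star (X i)) (X j + star (X j)) := fun i j =>
    ((h i j).add_left (h' i j)).add_right (((h' j i).symm).add_left (h'' i j))
  have hpm : ∀ i j, Commute (X i + star (X i)) (X j - star (X j)) := fun i j =>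
    ((h i j).add_left (h' i j)).sub_right (((h' j i).symm).add_left (h'' i j))
  have hm : ∀ i j, Commute (X i - star (X i)) (X j - star (X j)) := fun i j =>
    ((h i j).sub_left (h' i j)).sub_right (((h' j i).symm).sub_left (h'' i j))
  have hYc : ∀ k l, Commute (Y k) (Y l) := by
    rintro (i | i) (j | j)
    · exact hp i j
    · exact (hpm i j).smul_right _
    · exact (hpm j i).symm.smul_left _
    · exact ((hm i j).smul_left _).smul_right _
  have key := LinearMap.IsSymmetric.iSup_iInf_eq_top_of_commute
    (T := fun k => (Y k).toEuclideanLin) (fun k => Matrix.isSymmetric_toEuclideanLin_iff.2 (hY k))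
    (fun k l _ => (hYc k l).map (Matrix.toLpLinAlgEquiv (R := ℂ) 2))
  let f : EuclideanSpace ℂ n ≃ₗ[ℂ] (n → ℂ) := WithLp.linearEquiv 2 ℂ (n → ℂ)
  have hle : (⊤ : Submodule ℂ (EuclideanSpace ℂ n)) ≤ W.comap f.toLinearMap := by
    rw [← key]
    refine iSup_le fun χ v hv => ?_
    rw [Submodule.mem_iInf] at hv
    have hv' : ∀ k, (Y k).mulVec v.ofLp = χ k • v.ofLp := fun k =>
      congrArg WithLp.ofLp (Module.End.mem_eigenspace_iff.1 (hv k))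
    have h1 : ∀ i, (X i).mulVec v.ofLp + (star (X i)).mulVec v.ofLp =
        χ (Sum.inl i) • v.ofLp := fun i => by
      rw [← Matrix.add_mulVec]
      exact hv' (Sum.inl i)
    have h2 : ∀ i, (X i).mulVec v.ofLp - (star (X i)).mulVec v.ofLp =
        (-Complex.I * χ (Sum.inr i)) • v.ofLp := fun i => by
      rw [← Matrix.sub_mulVec, mul_smul, ← hv' (Sum.inr i)]
      change _ = -Complex.I • (Complex.I • (X i - star (X i))).mulVec v.ofLp
      rw [Matrix.smul_mulVec, smul_smul]
      simp
    refine hW v.ofLp (fun i => (χ (Sum.inl i) + -Complex.I * χ (Sum.inr i)) / 2)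
      (fun i => (χ (Sum.inl i) - -Complex.I * χ (Sum.inr i)) / 2) (fun i => ?_) (fun i => ?_)
    · rw [div_eq_inv_mul, mul_smul, add_smul, ← h1, ← h2, add_add_sub_cancel, ← two_smul ℂ,
        smul_smul]
      simp
    · rw [div_eq_inv_mul, mul_smul, sub_smul, ← h1, ← h2, add_sub_sub_cancel, ← two_smul ℂ,
        smul_smul]
      simp
  rw [eq_top_iff]
  intro v _
  exact hle (x := f.symm v) trivial

/-! ### Cocommutativity and commuting slices -/

namespace CompactQuantumGroup

variable {A : Type u} [CStarAlgebra A] {G : CompactQuantumGroup A} {n : ℕ}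
  {u : Matrix (Fin n) (Fin n) A}

/-- The matrix of values of a functional on the matrix coefficients. -/
def slice (u : Matrix (Fin n) (Fin n) A) (φ : VectorFunctional A) : Matrix (Fin n) (Fin n) ℂ :=
  u.map φ.lin

/-- The entries of the two products are `∑ₖ uᵢₖ ⊗ uₖⱼ = Δ(uᵢⱼ)` and `∑ₖ uₖⱼ ⊗ uᵢₖ`, its flip. -/
theorem commute_left_right (hcocomm : G.IsCocommutative) (hu : G.IsUnitaryRep u) :
    Commute (u.map (MinTensor.left A)) (u.map (MinTensor.right A)) := by
  ext i j
  rw [Matrix.mul_apply, Matrix.mul_apply]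
  simp only [Matrix.map_apply, MinTensor.left_mul_right, MinTensor.right_mul_left]
  rw [← hu.comul]
  apply MinTensor.val_injective
  rw [← hcocomm, hu.comul, map_sum, map_sum]
  simp only [MinTensor.flip_tmul]

/-- By unitarity the adjoint is the inverse, and the inverse of a commuting unit commutes. -/
theorem commute_star_left_right (hcocomm : G.IsCocommutative) (hu : G.IsUnitaryRep u) :
    Commute ((star u).map (MinTensor.left A)) (u.map (MinTensor.right A)) := by
  have h := commute_left_right hcocomm hu
  have h1 : (star u).map (MinTensor.left A) * u.map (MinTensor.left A) = 1 := by
    rw [← Matrix.map_mul, (Unitary.mem_iff.1 hu.unitary).1,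
      Matrix.map_one _ (map_zero _) (map_one _)]
  have h2 : u.map (MinTensor.left A) * (star u).map (MinTensor.left A) = 1 := by
    rw [← Matrix.map_mul, (Unitary.mem_iff.1 hu.unitary).2,
      Matrix.map_one _ (map_zero _) (map_one _)]
  exact Commute.units_inv_left (u := ⟨_, _, h2, h1⟩) h

theorem slice_commute (hcocomm : G.IsCocommutative) (hu : G.IsUnitaryRep u)
    (φ ψ : VectorFunctional A) : Commute (slice u φ) (slice u ψ) := by
  have h := commute_left_right hcocomm hu
  ext i j
  have h1 := congrArg (φ.prod ψ) (congrFun (congrFun h i) j)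
  rw [Matrix.mul_apply, Matrix.mul_apply] at h1 ⊢
  simp only [Matrix.map_apply, MinTensor.left_mul_right, MinTensor.right_mul_left, map_sum,
    VectorFunctional.prod_tmul] at h1
  simpa [slice, mul_comm] using h1

theorem star_slice (φ : VectorFunctional A) : star (slice u φ) = slice (star u) φ.conj := by
  ext i j
  simp [slice, Matrix.star_apply, VectorFunctional.conj_lin]

theorem star_slice_commute (hcocomm : G.IsCocommutative) (hu : G.IsUnitaryRep u)
    (φ ψ : VectorFunctional A) : Commute (star (slice u φ)) (slice u ψ) := by
  have h := commute_star_left_right hcocomm hu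
  rw [star_slice]
  ext i j
  have h1 := congrArg (φ.conj.prod ψ) (congrFun (congrFun h i) j)
  rw [Matrix.mul_apply, Matrix.mul_apply] at h1 ⊢
  simp only [Matrix.map_apply, MinTensor.left_mul_right, MinTensor.right_mul_left, map_sum,
    VectorFunctional.prod_tmul] at h1
  simpa [slice, mul_comm] using h1

end CompactQuantumGroup

/-! ### From joint eigenvectors to group-like unitaries -/

namespace CompactQuantumGroup

variable {A : Type u} [CStarAlgebra A] {G : CompactQuantumGroup A} {n : ℕ}
  {u : Matrix (Fin n) (Fin n) A}

/-- The normalized diagonal coefficient `⟪v, M v⟫ / ⟪v, v⟫` of a matrix over `A` at a vector. -/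
def coefficient (M : Matrix (Fin n) (Fin n) A) (v : Fin n → ℂ) : A :=
  (star v ⬝ᵥ v)⁻¹ • ∑ i, star (v i) • ∑ j, v j • M i j

theorem star_coefficient (M : Matrix (Fin n) (Fin n) A) (v : Fin n → ℂ) :
    star (coefficient M v) = coefficient (star M) v := by
  have h : star (star v ⬝ᵥ v)⁻¹ = (star v ⬝ᵥ v)⁻¹ := by
    rw [star_inv₀]
    simp [dotProduct, star_sum, mul_comm]
  rw [coefficient, coefficient, star_smul, h]
  congr 1
  simp only [star_smul, star_sum, star_star, star_mul, Finset.smul_sum, smul_smul,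
    Matrix.star_apply]
  rw [Finset.sum_comm]

open scoped ComplexOrder in
/-- A joint eigenvector of the slices is an eigenvector over `A`. -/
theorem sum_smul_eq_smul_coefficient (M : Matrix (Fin n) (Fin n) A) {v : Fin n → ℂ} (hv : v ≠ 0)
    (c : VectorFunctional A → ℂ) (h : ∀ φ, (slice M φ).mulVec v = c φ • v) (i : Fin n) :
    ∑ j, v j • M i j = v i • coefficient M v := by
  have h1 : ∀ (φ : VectorFunctional A) i, φ.lin (∑ j, v j • M i j) = c φ * v i := by
    intro φ i
    have := congrFun (h φ) i
    rw [Matrix.mulVec, dotProduct] at this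
    simpa [slice, mul_comm] using this
  have hN : star v ⬝ᵥ v ≠ 0 := by
    rwa [Ne, dotProduct_star_self_eq_zero]
  -- Vector functionals separate points, and each takes the value `c φ` on the coefficient.
  refine VectorFunctional.ext_lin fun φ => ?_
  rw [h1, coefficient, map_smul, map_smul, map_sum]
  have h2 : ∑ i, φ.lin (star (v i) • ∑ j, v j • M i j) = c φ * (star v ⬝ᵥ v) := by
    simp only [map_smul, h1, dotProduct, Finset.mul_sum, smul_eq_mul, Pi.star_apply]
    exact Finset.sum_congr rfl fun i _ => by ring
  rw [h2, smul_eq_mul, smul_eq_mul]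
  field_simp

/-- In the right module `Aⁿ`, the matrix sends `v ⊗ a` to `v ⊗ g a`; scalar coordinates of `v`
commute with everything. -/
theorem mulVec_smul_eq {M : Matrix (Fin n) (Fin n) A} {v : Fin n → ℂ} {g : A}
    (h : ∀ i, ∑ j, v j • M i j = v i • g) (a : A) :
    M.mulVec (fun i => v i • a) = fun i => v i • (g * a) := by
  funext i
  rw [Matrix.mulVec, dotProduct, ← smul_mul_assoc, ← h, Finset.sum_mul]
  exact Finset.sum_congr rfl fun j _ => by rw [mul_smul_comm, smul_mul_assoc]

theorem mul_eq_one_of_mulVec {M M' : Matrix (Fin n) (Fin n) A} {v : Fin n → ℂ} (hv : v ≠ 0)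
    {g g' : A} (h : ∀ i, ∑ j, v j • M i j = v i • g) (h' : ∀ i, ∑ j, v j • M' i j = v i • g')
    (hM : M * M' = 1) : g * g' = 1 := by
  obtain ⟨i, hi⟩ := Function.ne_iff.1 hv
  have h1 : (M * M').mulVec (fun i => v i • (1 : A)) = fun i => v i • (g * g') := by
    rw [← Matrix.mulVec_mulVec, mulVec_smul_eq h', mulVec_smul_eq h, mul_one]
  rw [hM, Matrix.one_mulVec] at h1
  exact (smul_right_injective A hi (congrFun h1 i)).symm

/-- Unitarity passes from `u` to its eigenvalue `g`. For `Δ`, the eigenvector equation in the second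
leg gives `Δ(∑ⱼ vⱼ uᵢⱼ) = (∑ₖ vₖ uᵢₖ) ⊗ g`; pairing with `v` gives `Δ g = g ⊗ g`. -/
theorem isGroupLike_coefficient (hu : G.IsUnitaryRep u) {v : Fin n → ℂ} (hv : v ≠ 0)
    (h : ∀ i, ∑ j, v j • u i j = v i • coefficient u v)
    (h' : ∀ i, ∑ j, v j • (star u) i j = v i • star (coefficient u v)) :
    G.IsGroupLike (coefficient u v) where
  mem_unitary := ⟨mul_eq_one_of_mulVec hv h' h (Unitary.mem_iff.1 hu.unitary).1,
    mul_eq_one_of_mulVec hv h h' (Unitary.mem_iff.1 hu.unitary).2⟩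
  comul := by
    -- Naming the coefficient lets only the first tensor leg be unfolded below.
    obtain ⟨g, hg⟩ : ∃ g, coefficient u v = g := ⟨_, rfl⟩
    rw [hg] at h ⊢
    have h1 : ∀ i, G.Δ (∑ j, v j • u i j) = MinTensor.tmul (∑ j, v j • u i j) g := by
      intro i
      simp only [map_sum, map_smul, hu.comul, MinTensor.tmul_sum_left, MinTensor.smul_tmul']
      simp only [Finset.smul_sum]
      rw [Finset.sum_comm]
      refine Finset.sum_congr rfl fun k _ => ?_
      simp only [← MinTensor.tmul_smul, ← MinTensor.tmul_sum_right, h]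
    have h2 : G.Δ (coefficient u v) = MinTensor.tmul (coefficient u v) g := by
      rw [coefficient, map_smul, map_sum, MinTensor.smul_tmul', MinTensor.tmul_sum_left]
      simp only [map_smul _ (star _), MinTensor.smul_tmul', h1]
    rwa [hg] at h2

/-- Otherwise every joint eigenvector of the slices is fixed by `u`. These span `ℂⁿ`, so the
standard basis is fixed and `u = 1`. -/
theorem exists_eigenvector_ne_one (hcocomm : G.IsCocommutative) (hu : G.IsUnitaryRep u)
    (hne : u ≠ 1) : ∃ (v : Fin n → ℂ) (g : A), v ≠ 0 ∧ G.IsGroupLike g ∧ g ≠ 1 ∧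
      ∀ i, ∑ j, v j • u i j = v i • g := by
  by_contra! hcon
  refine hne ?_
  let W : Submodule ℂ (Fin n → ℂ) :=
    { carrier := {v | ∀ i, ∑ j, v j • u i j = v i • (1 : A)}
      zero_mem' := fun i => by simp
      add_mem' := fun {v w} hv hw i => by
        simp only [Pi.add_apply, add_smul, Finset.sum_add_distrib, hv i, hw i]
      smul_mem' := fun c v hv i => by
        simp only [Pi.smul_apply, smul_assoc, ← Finset.smul_sum, hv i] }
  have hW : W = ⊤ := by
    refine Matrix.eq_top_of_joint_eigenvectors_mem (slice u) (slice_commute hcocomm hu)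
      (star_slice_commute hcocomm hu) W fun v c d hc hd => ?_
    rcases eq_or_ne v 0 with rfl | hv
    · exact zero_mem W
    have h := sum_smul_eq_smul_coefficient u hv c hc
    have h' := sum_smul_eq_smul_coefficient (star u) hv (fun φ => d φ.conj) (fun φ => by
      rw [← hd φ.conj, star_slice]
      rfl)
    rw [← star_coefficient] at h'
    by_contra hvW
    have hg1 : coefficient u v ≠ 1 := fun h1 => hvW (by rwa [h1] at h)
    obtain ⟨i, hi⟩ := hcon v _ hv (isGroupLike_coefficient hu hv h h') hg1
    exact hi (h i)
  ext i j
  have h1 : Pi.single j 1 ∈ W := hW ▸ Submodule.mem_top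
  have h2 := h1 i
  simpa [Pi.single_apply, Matrix.one_apply, ite_smul] using h2

end CompactQuantumGroup

/-! ### The spectrum of the representation -/

theorem Matrix.spectrum_subset_sphere_of_mem_unitary {A : Type*} [CStarAlgebra A] {n : Type*}
    [Fintype n] [DecidableEq n] {u : Matrix n n A} (hu : u ∈ unitary (Matrix n n A)) :
    spectrum ℂ u ⊆ Metric.sphere (0 : ℂ) 1 := by
  let _ : PartialOrder A := CStarAlgebra.spectralOrder A
  have : StarOrderedRing A := CStarAlgebra.spectralOrderedRing A
  -- `CStarMatrix` carries the C⋆-norm; unitarity and spectrum depend only on the shared ⋆-algebra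
  -- structure.
  have h : CStarMatrix.ofMatrix u ∈ unitary (CStarMatrix n n A) := hu
  exact spectrum.subset_circle_of_unitary (𝕜 := ℂ) h

end

theorem mainTheorem5 {A : Type u} [CStarAlgebra A] (G : CompactQuantumGroup A)
    (hconn : G.IsConnected) (hcocomm : G.IsCocommutative)
    {n : ℕ} (u : Matrix (Fin n) (Fin n) A) (hu : G.IsUnitaryRep u) (hne : u ≠ 1) :
    spectrum ℂ u = Metric.sphere (0 : ℂ) 1 := by
  refine (Matrix.spectrum_subset_sphere_of_mem_unitary hu.unitary).antisymm fun z hz => ?_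
  obtain ⟨v, g, hv, hg, hg1, h⟩ :=
    CompactQuantumGroup.exists_eigenvector_ne_one hcocomm hu hne
  have hzg := hg.sphere_subset_spectrum hconn hg1 hz
  have : IsStarNormal g := isStarNormal_of_mem_unitary hg.mem_unitary
  obtain ⟨p, ξ, hξ, hp⟩ := exists_cstarRep_eigenvector g hzg
  rw [spectrum.mem_iff]
  intro hunit
  obtain ⟨w, hw⟩ := hunit.exists_left_inv
  obtain ⟨i, hi⟩ := Function.ne_iff.1 hv
  have h1 : ∀ i, ∑ j, v j • (algebraMap ℂ (Matrix (Fin n) (Fin n) A) z - u) i j =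
      v i • (algebraMap ℂ A z - g) := by
    intro i
    simp only [Matrix.sub_apply, smul_sub, Finset.sum_sub_distrib, h,
      Matrix.algebraMap_matrix_apply, smul_ite, smul_zero, Finset.sum_ite_eq, Finset.mem_univ, if_true]
  have h2 := CompactQuantumGroup.mulVec_smul_eq h1 1
  have h3 : w.mulVec (fun i => v i • (algebraMap ℂ A z - g)) = fun i => v i • (1 : A) := by
    rw [mul_one] at h2
    rw [← h2, Matrix.mulVec_mulVec, hw, Matrix.one_mulVec]
  -- The witness is the `i`-th coordinate of `w` applied to `v ⊗ 1`, divided by `v i ≠ 0`; `h3` at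
  -- `i` shows that it is a left inverse of `z - g`.
  refine not_left_inverse_of_eigenvector (w := (v i)⁻¹ • ∑ j, v j • w i j) p hξ hp ?_
  have h4 := congrFun h3 i
  rw [Matrix.mulVec, dotProduct] at h4
  rw [smul_mul_assoc, Finset.sum_mul]
  simp only [smul_mul_assoc, ← mul_smul_comm]
  rw [h4, smul_smul, inv_mul_cancel₀ hi, one_smul]
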